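/- **Definitions.** All alphabets are finite. A channel $P=P_{Y|X}$ from $X$ to $Y$ is a stochastic matrix $P(y|x)$; $P\circ P_X$ denotes the output distribution for the input distribution $P_X$. A channel with input alphabet $\{0,1\}$ and finite output alphabet $\mathcal Y$ is *binary input symmetric output* (BISO) if there is an involution $y\mapsto -y$ of $\mathcal Y$ (for example ordinary negation on $\mathcal Y=\{0,\pm1,\dots,\pm l\}$) with $P(y|0)=P(-y|1)$ for all $y\in\mathcal Y$. $BSC_p$ is the binary symmetric channel with crossover probability $p\in[0,1]$ and $BEC(\varepsilon)$ the binary erasure channel with erasure probability $\varepsilon\in[0,1]$. For channels $P_{Y|X}$, $Q_{Y'|X}$ with the same input alphabet, write $P\succeq_{\mathrm{deg}}Q$ if $Q=D\circ P$ for some channel $D_{Y'|Y}$, and $P\succeq_{\mathrm{l.n.}}Q$ ($P$ is less noisy than $Q$) if $I(U:Y)\ge I(U:Y')$ for every joint distribution $P_{UX}$ with $U$ finite-valued, where $U-X-Y$ and $U-X-Y'$ are Markov chains. For a binary-input channel $P$ let $$\alpha(P)=\sum_{y}\min_x P(y|x),\qquad \widecheck\alpha(P)=\inf\{2p : p\in[0,1],\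 P\succeq_{\mathrm{deg}}BSC_p\},$$ $$\beta(P)=\sup\{\varepsilon\in[0,1] : BEC(\varepsilon)\succeq_{\mathrm{l.n.}}P\},\qquad \widecheck\beta(P)=\inf\{4p(1-p) : p\in[0,1],\ P\succeq_{\mathrm{l.n.}}BSC_p\},$$ $$\eta_{TV}(P)=\sup_{P_X\ne Q_X}\frac{TV(P\circ P_X,P\circ Q_X)}{TV(P_X,Q_X)},\qquad \eta_{KL}(P)=\sup_{0<D(P_X\|Q_X)<\infty}\frac{D(P\circ P_X\|P\circ Q_X)}{D(P_X\|Q_X)},$$ where the suprema in the last line are over pairs of input distributions. **Proposition.** For every BISO channel $P$, 1. $\alpha(P)=\widecheck\alpha(P)=1-\eta_{TV}(P)$; 2. $\beta(P)=\widecheck\beta(P)=1-\eta_{KL}(P)$. -/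

import Mathlib

open scoped Matrix BigOperators

namespace InfoTheory

/-- A (discrete memoryless) channel from the input alphabet `X` to the finite output alphabet `Y`:
a row-stochastic matrix, with `W x y` the probability `W(y | x)`. -/
def IsChannel {X Y : Type*} [Fintype Y] (W : Matrix X Y ℝ) : Prop :=
  ∀ x, W x ∈ stdSimplex ℝ Y

/-- Binary-input symmetric-output: the output alphabet carries an involution `σ` (which is
`y ↦ -y` when the alphabet is `{0, ±1, …, ±l}`) with `W(y | 0) = W(σ y | 1)` for every `y`. -/
def IsBISO {Y : Type*} (W : Matrix (Fin 2) Y ℝ) : Prop :=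
  ∃ σ : Y → Y, Function.Involutive σ ∧ ∀ y, W 0 y = W 1 (σ y)

/-- The binary symmetric channel with crossover probability `p`. -/
def BSC (p : ℝ) : Matrix (Fin 2) (Fin 2) ℝ :=
  !![1 - p, p;
     p, 1 - p]

/-- The binary erasure channel with erasure probability `ε`; the middle output is the erasure
symbol. -/
def BEC (ε : ℝ) : Matrix (Fin 2) (Fin 3) ℝ :=
  !![1 - ε, ε, 0;
     0, ε, 1 - ε]

/-- Total variation distance of two distributions on a finite set. -/
noncomputable def tvDistance {A : Type*} [Fintype A] (P Q : A → ℝ) : ℝ :=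
  (∑ a, |P a - Q a|) / 2

/-- `P` is absolutely continuous with respect to `Q`; for distributions on a finite set this
says that `D(P ‖ Q) < ∞`. -/
def AbsCont {A : Type*} (P Q : A → ℝ) : Prop :=
  ∀ a, Q a = 0 → P a = 0

/-- Relative entropy `D(P ‖ Q)` (in nats) of distributions on a finite set with `AbsCont P Q`; it
is used only for such pairs, where it is finite. -/
noncomputable def relEntropy {A : Type*} [Fintype A] (P Q : A → ℝ) : ℝ :=
  ∑ a, P a * Real.log (P a / Q a)

/-- Mutual information `I(U : Y)` of a pair with joint distribution `J`: the relative entropy from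
the joint distribution to the product of its marginals (with respect to which it is always
absolutely continuous). -/
noncomputable def mutualInfo {U Y : Type*} [Fintype U] [Fintype Y] (J : Matrix U Y ℝ) : ℝ :=
  relEntropy (fun z : U × Y => J z.1 z.2)
    (fun z : U × Y => (∑ y, J z.1 y) * (∑ u, J u z.2))

/-- `J` is a joint distribution on `U × X`. -/
def IsJointDist {U X : Type*} [Fintype U] [Fintype X] (J : Matrix U X ℝ) : Prop :=
  (∀ u x, 0 ≤ J u x) ∧ ∑ u, ∑ x, J u x = 1

/-- `W` is less noisy than `V`: `I(U : Y) ≥ I(U : Y')` for all joint distributions `J` of `(U, X)`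
with `U` finite-valued, where `U - X - Y` and `U - X - Y'` are Markov chains, so that `(U, Y)` and
`(U, Y')` have the joint distributions `J * W` and `J * V`. -/
def LessNoisy {X Y Y' : Type*} [Fintype X] [Fintype Y] [Fintype Y']
    (W : Matrix X Y ℝ) (V : Matrix X Y' ℝ) : Prop :=
  ∀ (k : ℕ) (J : Matrix (Fin k) X ℝ), IsJointDist J → mutualInfo (J * V) ≤ mutualInfo (J * W)

/-- `W` is degradable into `V`: `V` is `W` followed by some channel `D`. -/
def DegradableInto {X Y Y' : Type*} [Fintype Y] [Fintype Y']
    (W : Matrix X Y ℝ) (V : Matrix X Y' ℝ) : Prop :=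
  ∃ D : Matrix Y Y' ℝ, IsChannel D ∧ V = W * D

/-- KL contraction coefficient: the supremum of `D(PW ‖ QW) / D(P ‖ Q)` over input distributions
with `0 < D(P ‖ Q) < ∞`, that is, with `P ≠ Q` and `P` absolutely continuous with respect to
`Q`. -/
noncomputable def etaKL {X Y : Type*} [Fintype X] [Fintype Y] (W : Matrix X Y ℝ) : ℝ :=
  sSup {r : ℝ | ∃ P ∈ stdSimplex ℝ X, ∃ Q ∈ stdSimplex ℝ X, P ≠ Q ∧ AbsCont P Q ∧
    r = relEntropy (P ᵥ* W) (Q ᵥ* W) / relEntropy P Q}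

/-- Dobrushin coefficient: the supremum of `TV(PW, QW) / TV(P, Q)` over distinct input
distributions. -/
noncomputable def etaTV {X Y : Type*} [Fintype X] [Fintype Y] (W : Matrix X Y ℝ) : ℝ :=
  sSup {r : ℝ | ∃ P ∈ stdSimplex ℝ X, ∃ Q ∈ stdSimplex ℝ X, P ≠ Q ∧
    r = tvDistance (P ᵥ* W) (Q ᵥ* W) / tvDistance P Q}

/-- Doeblin coefficient `α(W) = ∑ y, min over x of W(y | x)`. -/
noncomputable def doeblin {X Y : Type*} [Fintype Y] (W : Matrix X Y ℝ) : ℝ :=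
  ∑ y, ⨅ x, W x y

/-- Reverse Doeblin coefficient `α̌(W) = inf {2p : W ⪰_deg BSC_p}`. -/
noncomputable def reverseDoeblin {Y : Type*} [Fintype Y] (W : Matrix (Fin 2) Y ℝ) : ℝ :=
  sInf {r : ℝ | ∃ p ∈ Set.Icc (0 : ℝ) 1, DegradableInto W (BSC p) ∧ r = 2 * p}

/-- `β(W) = sup {ε : BEC(ε) ⪰_l.n. W}`. -/
noncomputable def lnCoeff {Y : Type*} [Fintype Y] (W : Matrix (Fin 2) Y ℝ) : ℝ :=
  sSup {ε : ℝ | ε ∈ Set.Icc (0 : ℝ) 1 ∧ LessNoisy (BEC ε) W}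

/-- `β̌(W) = inf {4p(1-p) : W ⪰_l.n. BSC_p}`. -/
noncomputable def reverseLnCoeff {Y : Type*} [Fintype Y] (W : Matrix (Fin 2) Y ℝ) : ℝ :=
  sInf {r : ℝ | ∃ p ∈ Set.Icc (0 : ℝ) 1, LessNoisy W (BSC p) ∧ r = 4 * p * (1 - p)}

end InfoTheory

/-!
All six coefficients of a symmetric channel `W` are functions of two numbers.

For the total variation part, every ratio defining `etaTV W` equals the total variation distance of
the two rows, because the difference of two binary distributions is a multiple of `(1, -1)`; this
distance is `1 - doeblin W`. Data processing bounds `p` from below whenever `W` degrades into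
`BSC p`, and maximum-likelihood decoding with a fair tie-break attains the bound, the symmetry of
`W` making the two error probabilities equal.

For the relative entropy part, parametrise the inputs by their bias `x ∈ [-1, 1]`, so that the
output distribution is `m + x d` with `m`, `d` half the sum and half the difference of the rows,
and let `F x = ∑ y, (m + x d) log (m + x d)`. Mutual information is the gap in Jensen's inequality
for `F` (`mutualInfo_mul`), and relative entropy is the Bregman divergence of `F`
(`relEntropy_outputAt`). Hence convexity of `F_W - F_V`, or of `c * F_1 - F_W`, which is an
inequality between the Fisher informations `F''`, gives the less-noisy order and the strong data
processing inequality. With `c = ∑ y, d² / m`, the symmetry of `W` yields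
`c / (1 - c x²) ≤ F_W'' x ≤ c / (1 - x²)` (`le_fisherInfo`, `fisherInfo_le`), and the two bounds
are the Fisher informations of `BSC p` with `(1 - 2 p)² = c` and of `BEC (1 - c)`. Thus `W` lies
between these two channels in the less-noisy order. That nothing better is possible follows from
`F x - F 0 ∼ c x² / 2` as `x → 0` (`tendsto_negEntropyAt_div_sq`): the less-noisy order and the
contraction of relative entropy near the uniform input both see `c`.
-/

namespace InfoTheory

open Filter Topology

section Bias

variable {Y : Type*} (W : Matrix (Fin 2) Y ℝ)

/-- The output distribution of a binary-input channel for the uniform input. -/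
noncomputable def midpoint (y : Y) : ℝ := (W 0 y + W 1 y) / 2

/-- Half of the difference of the two rows of a binary-input channel. -/
noncomputable def halfDiff (y : Y) : ℝ := (W 0 y - W 1 y) / 2

/-- The output distribution for the input distribution `((1 + x) / 2, (1 - x) / 2)` of bias `x`. -/
noncomputable def outputAt (x : ℝ) (y : Y) : ℝ := midpoint W y + x * halfDiff W y

/-- The negative of the output entropy, as a function of the bias `x` of the input. -/
noncomputable def negEntropyAt [Fintype Y] (x : ℝ) : ℝ :=
  ∑ y, outputAt W x y * Real.log (outputAt W x y)

/-- The derivative of `negEntropyAt W` on `(-1, 1)`. -/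
noncomputable def negEntropyDeriv [Fintype Y] (x : ℝ) : ℝ :=
  ∑ y, halfDiff W y * (Real.log (outputAt W x y) + 1)

/-- The Fisher information `∑ y, d(y)² / (m(y) + x d(y))` of the output distribution with respect
to the bias of the input; it is the second derivative of `negEntropyAt W` on `(-1, 1)`. -/
noncomputable def fisherInfo [Fintype Y] (x : ℝ) : ℝ :=
  ∑ y, halfDiff W y ^ 2 / outputAt W x y

/-- The common value of the contraction coefficient and the complements of the less-noisy
coefficients of a symmetric channel: the Fisher information at the uniform input, which is the
squared maximal correlation between a uniform input and the output. -/
noncomputable def corrSq [Fintype Y] : ℝ := ∑ y, halfDiff W y ^ 2 / midpoint W y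

end Bias

/-! ### Binary-input channels in terms of the input bias -/

section Channel

variable {Y : Type*} {W : Matrix (Fin 2) Y ℝ}

lemma vecMul_eq_outputAt {P : Fin 2 → ℝ} (hP : P ∈ stdSimplex ℝ (Fin 2)) :
    P ᵥ* W = outputAt W (P 0 - P 1) := by
  ext y
  have h : P 0 + P 1 = 1 := by simpa using hP.2
  simp only [Matrix.vecMul, dotProduct, Fin.sum_univ_two, outputAt, midpoint, halfDiff]
  linear_combination ((W 0 y + W 1 y) / 2) * h

variable [Fintype Y]

lemma abs_halfDiff_le (hW : IsChannel W) (y : Y) : |halfDiff W y| ≤ midpoint W y := by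
  have h0 := (hW 0).1 y
  have h1 := (hW 1).1 y
  rw [abs_le]
  unfold halfDiff midpoint
  constructor <;> linarith

lemma midpoint_nonneg (hW : IsChannel W) (y : Y) : 0 ≤ midpoint W y :=
  (abs_nonneg _).trans (abs_halfDiff_le hW y)

lemma halfDiff_eq_zero (hW : IsChannel W) {y : Y} (h : midpoint W y = 0) : halfDiff W y = 0 :=
  abs_nonpos_iff.1 (h ▸ abs_halfDiff_le hW y)

lemma sum_midpoint (hW : IsChannel W) : ∑ y, midpoint W y = 1 := by
  simp only [midpoint, ← Finset.sum_div, Finset.sum_add_distrib, (hW 0).2, (hW 1).2]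
  norm_num

lemma sum_halfDiff (hW : IsChannel W) : ∑ y, halfDiff W y = 0 := by
  simp only [halfDiff, ← Finset.sum_div, Finset.sum_sub_distrib, (hW 0).2, (hW 1).2]
  norm_num

lemma sum_outputAt (hW : IsChannel W) (x : ℝ) : ∑ y, outputAt W x y = 1 := by
  simp only [outputAt, Finset.sum_add_distrib, ← Finset.mul_sum, sum_midpoint hW,
    sum_halfDiff hW, mul_zero, add_zero]

lemma abs_bias_mul_halfDiff_le (hW : IsChannel W) (x : ℝ) (y : Y) :
    |x * halfDiff W y| ≤ |x| * midpoint W y := by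
  rw [abs_mul]
  exact mul_le_mul_of_nonneg_left (abs_halfDiff_le hW y) (abs_nonneg x)

lemma outputAt_pos (hW : IsChannel W) {x : ℝ} (hx : |x| < 1) {y : Y} (hy : midpoint W y ≠ 0) :
    0 < outputAt W x y := by
  have h := neg_le_of_abs_le (abs_bias_mul_halfDiff_le hW x y)
  have h' := mul_lt_mul_of_pos_right hx ((midpoint_nonneg hW y).lt_of_ne' hy)
  unfold outputAt
  linarith

lemma abs_bias_le_one {P : Fin 2 → ℝ} (hP : P ∈ stdSimplex ℝ (Fin 2)) : |P 0 - P 1| ≤ 1 := by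
  have h : P 0 + P 1 = 1 := by simpa using hP.2
  have h0 := hP.1 0
  have h1 := hP.1 1
  rw [abs_le]
  constructor <;> linarith

/-- The input distribution of bias `x`. -/
noncomputable def biased (x : ℝ) : Fin 2 → ℝ := ![(1 + x) / 2, (1 - x) / 2]

lemma biased_mem {x : ℝ} (hx : |x| ≤ 1) : biased x ∈ stdSimplex ℝ (Fin 2) := by
  obtain ⟨h1, h2⟩ := abs_le.1 hx
  refine ⟨fun i => ?_, ?_⟩
  · fin_cases i
    · show 0 ≤ (1 + x) / 2
      linarith
    · show 0 ≤ (1 - x) / 2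
      linarith
  · simp only [biased, Fin.sum_univ_two, Matrix.cons_val_zero, Matrix.cons_val_one]
    ring

lemma biased_sub (x : ℝ) : biased x 0 - biased x 1 = x := by
  simp only [biased, Matrix.cons_val_zero, Matrix.cons_val_one]
  ring

lemma eq_of_bias_eq {P Q : Fin 2 → ℝ} (hP : P ∈ stdSimplex ℝ (Fin 2))
    (hQ : Q ∈ stdSimplex ℝ (Fin 2)) (h : P 0 - P 1 = Q 0 - Q 1) : P = Q := by
  have h1 : P 0 + P 1 = 1 := by simpa using hP.2
  have h2 : Q 0 + Q 1 = 1 := by simpa using hQ.2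
  ext i
  fin_cases i
  · show P 0 = Q 0
    linarith
  · show P 1 = Q 1
    linarith

/-- Absolute continuity between distinct binary distributions forces the second to be
non-degenerate. -/
lemma abs_bias_lt_one {P Q : Fin 2 → ℝ} (hP : P ∈ stdSimplex ℝ (Fin 2))
    (hQ : Q ∈ stdSimplex ℝ (Fin 2)) (hne : P ≠ Q) (hac : AbsCont P Q) : |Q 0 - Q 1| < 1 := by
  have h1 : P 0 + P 1 = 1 := by simpa using hP.2
  have h2 : Q 0 + Q 1 = 1 := by simpa using hQ.2
  have hQ0 : Q 0 ≠ 0 := fun h => hne <| eq_of_bias_eq hP hQ (by linarith [hac 0 h])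
  have hQ1 : Q 1 ≠ 0 := fun h => hne <| eq_of_bias_eq hP hQ (by linarith [hac 1 h])
  have h0 := (hQ.1 0).lt_of_ne' hQ0
  have h1 := (hQ.1 1).lt_of_ne' hQ1
  rw [abs_lt]
  constructor <;> linarith

end Channel

/-! ### Total variation and the Doeblin coefficients -/

section Doeblin

variable {Y : Type*} [Fintype Y] {W : Matrix (Fin 2) Y ℝ}

lemma tvDistance_rows : tvDistance (W 0) (W 1) = ∑ y, |halfDiff W y| := by
  simp only [tvDistance, halfDiff, abs_div, abs_two, Finset.sum_div]

lemma tvDistance_outputAt (a b : ℝ) :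
    tvDistance (outputAt W a) (outputAt W b) = |a - b| / 2 * tvDistance (W 0) (W 1) := by
  have h : ∀ y, |outputAt W a y - outputAt W b y| = |a - b| * |halfDiff W y| := fun y => by
    rw [← abs_mul]
    congr 1
    unfold outputAt
    ring
  rw [tvDistance_rows, tvDistance]
  simp only [h, ← Finset.mul_sum]
  ring

lemma tvDistance_eq_abs_bias_sub {P Q : Fin 2 → ℝ} (hP : P ∈ stdSimplex ℝ (Fin 2))
    (hQ : Q ∈ stdSimplex ℝ (Fin 2)) :
    tvDistance P Q = |(P 0 - P 1) - (Q 0 - Q 1)| / 2 := by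
  have h1 : P 0 + P 1 = 1 := by simpa using hP.2
  have h2 : Q 0 + Q 1 = 1 := by simpa using hQ.2
  have h3 : P 1 - Q 1 = -(P 0 - Q 0) := by linarith
  have h4 : (P 0 - P 1) - (Q 0 - Q 1) = 2 * (P 0 - Q 0) := by linarith
  rw [tvDistance, Fin.sum_univ_two, h3, h4, abs_neg, abs_mul, abs_two]
  ring

/-- For binary inputs every ratio in the definition of the Dobrushin coefficient equals the total
variation distance of the two rows. -/
lemma etaTV_eq : etaTV W = tvDistance (W 0) (W 1) := by
  have hr : ∀ P ∈ stdSimplex ℝ (Fin 2), ∀ Q ∈ stdSimplex ℝ (Fin 2), P ≠ Q →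
      tvDistance (P ᵥ* W) (Q ᵥ* W) / tvDistance P Q = tvDistance (W 0) (W 1) := by
    intro P hP Q hQ hne
    have h0 : |(P 0 - P 1) - (Q 0 - Q 1)| ≠ 0 := by
      rw [abs_ne_zero, sub_ne_zero]
      exact fun h => hne (eq_of_bias_eq hP hQ h)
    rw [vecMul_eq_outputAt hP, vecMul_eq_outputAt hQ, tvDistance_outputAt,
      tvDistance_eq_abs_bias_sub hP hQ]
    field_simp
  have hset : {r : ℝ | ∃ P ∈ stdSimplex ℝ (Fin 2), ∃ Q ∈ stdSimplex ℝ (Fin 2), P ≠ Q ∧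
      r = tvDistance (P ᵥ* W) (Q ᵥ* W) / tvDistance P Q} = {tvDistance (W 0) (W 1)} := by
    refine Set.Subset.antisymm ?_ (Set.singleton_subset_iff.2 ?_)
    · rintro r ⟨P, hP, Q, hQ, hne, rfl⟩
      exact hr P hP Q hQ hne
    · have hP := biased_mem (x := 1) (by simp)
      have hQ := biased_mem (x := 0) (by simp)
      have hne : biased 1 ≠ biased 0 := fun h => by
        have h1 := biased_sub 1
        rw [h, biased_sub] at h1
        norm_num at h1
      exact ⟨_, hP, _, hQ, hne, (hr _ hP _ hQ hne).symm⟩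
  rw [etaTV, hset, csSup_singleton]

lemma doeblin_eq (hW : IsChannel W) : doeblin W = 1 - tvDistance (W 0) (W 1) := by
  have h : ∀ y, ⨅ x, W x y = midpoint W y - |halfDiff W y| := fun y => by
    have : ⨅ x, W x y = min (W 0 y) (W 1 y) := by
      refine le_antisymm (le_min (ciInf_le (Set.finite_range _).bddBelow 0)
        (ciInf_le (Set.finite_range _).bddBelow 1)) (le_ciInf fun x => ?_)
      fin_cases x
      exacts [min_le_left _ _, min_le_right _ _]
    rw [this, midpoint, halfDiff, abs_div, abs_two]
    rcases le_total (W 0 y) (W 1 y) with h | h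
    · rw [min_eq_left h, abs_of_nonpos (sub_nonpos.2 h)]
      ring
    · rw [min_eq_right h, abs_of_nonneg (sub_nonneg.2 h)]
      ring
  rw [tvDistance_rows, doeblin, Finset.sum_congr rfl fun y _ => h y, Finset.sum_sub_distrib,
    sum_midpoint hW]

lemma doeblin_nonneg (hW : IsChannel W) : 0 ≤ doeblin W :=
  Finset.sum_nonneg fun y _ => le_ciInf fun x => (hW x).1 y

/-- Data processing for the total variation distance of the two rows. -/
lemma one_sub_two_mul_le_of_degradableInto {p : ℝ} (h : DegradableInto W (BSC p)) :
    1 - 2 * p ≤ tvDistance (W 0) (W 1) := by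
  obtain ⟨D, hD, hp⟩ := h
  have e0 : 1 - p = ∑ y, W 0 y * D y 0 := by
    simpa [BSC, Matrix.mul_apply] using congrFun (congrFun hp 0) 0
  have e1 : p = ∑ y, W 1 y * D y 0 := by
    simpa [BSC, Matrix.mul_apply] using congrFun (congrFun hp 1) 0
  have e2 : p = ∑ y, W 0 y * D y 1 := by
    simpa [BSC, Matrix.mul_apply] using congrFun (congrFun hp 0) 1
  have e3 : 1 - p = ∑ y, W 1 y * D y 1 := by
    simpa [BSC, Matrix.mul_apply] using congrFun (congrFun hp 1) 1
  have e : 1 - 2 * p = ∑ y, halfDiff W y * (D y 0 - D y 1) := by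
    have : ∑ y, halfDiff W y * (D y 0 - D y 1) = (∑ y, W 0 y * D y 0 - ∑ y, W 1 y * D y 0
        - ∑ y, W 0 y * D y 1 + ∑ y, W 1 y * D y 1) / 2 := by
      simp only [← Finset.sum_sub_distrib, ← Finset.sum_add_distrib, Finset.sum_div, halfDiff]
      exact Finset.sum_congr rfl fun y _ => by ring
    rw [this, ← e0, ← e1, ← e2, ← e3]
    ring
  rw [e, tvDistance_rows]
  refine Finset.sum_le_sum fun y _ => (le_abs_self _).trans ?_
  rw [abs_mul]
  exact mul_le_of_le_one_right (abs_nonneg _) (abs_bias_le_one (hD y))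

/-- Maximum-likelihood decoding, with ties broken by a fair coin, turns a symmetric channel into a
binary symmetric channel. -/
lemma degradableInto_of_isBISO (hW : IsChannel W) (hB : IsBISO W) :
    DegradableInto W (BSC (doeblin W / 2)) := by
  obtain ⟨σ, hσ, hs⟩ := hB
  have hs' : ∀ y, W 1 y = W 0 (σ y) := fun y => by rw [hs, hσ]
  have hd : ∀ y, halfDiff W (σ y) = -halfDiff W y := fun y => by
    rw [halfDiff, halfDiff, hs y, hs' y]
    ring
  set s : Y → ℝ := fun y => SignType.sign (halfDiff W y) with hsdef
  have hsσ : ∀ y, s (σ y) = -s y := fun y => by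
    simp [hsdef, hd, Left.sign_neg]
  have hs1 : ∀ y, |s y| ≤ 1 := fun y => by
    rcases lt_trichotomy (halfDiff W y) 0 with h | h | h <;> simp [hsdef, h]
  have hflip : ∑ y, W 1 y * s y = -∑ y, W 0 y * s y := by
    rw [← Equiv.sum_comp hσ.toPerm, ← Finset.sum_neg_distrib]
    refine Finset.sum_congr rfl fun y _ => ?_
    simp only [Function.Involutive.coe_toPerm, ← hs, hsσ]
    ring
  have htv : ∑ y, W 0 y * s y = tvDistance (W 0) (W 1) := by
    have h : tvDistance (W 0) (W 1) = (∑ y, W 0 y * s y - ∑ y, W 1 y * s y) / 2 := by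
      rw [tvDistance_rows, ← Finset.sum_sub_distrib, Finset.sum_div]
      refine Finset.sum_congr rfl fun y _ => ?_
      rw [← self_mul_sign (halfDiff W y), halfDiff]
      simp only [hsdef, halfDiff]
      ring
    rw [h, hflip]
    ring
  refine ⟨Matrix.of fun y => biased (s y), fun y => biased_mem (hs1 y), ?_⟩
  have h0 := (hW 0).2
  have h1 := (hW 1).2
  have hplus : ∀ i, ∑ y, W i y * ((1 + s y) / 2) = (∑ y, W i y + ∑ y, W i y * s y) / 2 :=
    fun i => by
      rw [← Finset.sum_add_distrib, Finset.sum_div]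
      exact Finset.sum_congr rfl fun y _ => by ring
  have hminus : ∀ i, ∑ y, W i y * ((1 - s y) / 2) = (∑ y, W i y - ∑ y, W i y * s y) / 2 :=
    fun i => by
      rw [← Finset.sum_sub_distrib, Finset.sum_div]
      exact Finset.sum_congr rfl fun y _ => by ring
  rw [doeblin_eq hW]
  ext i j
  fin_cases i <;> fin_cases j <;>
    simp [BSC, Matrix.mul_apply, biased, hplus, hminus, hflip, htv, h0, h1] <;> ring

lemma reverseDoeblin_eq (hW : IsChannel W) (hB : IsBISO W) :
    reverseDoeblin W = 1 - tvDistance (W 0) (W 1) := by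
  refine IsLeast.csInf_eq ⟨?_, ?_⟩
  · have h0 := doeblin_nonneg hW
    have h1 : 0 ≤ tvDistance (W 0) (W 1) := by
      rw [tvDistance_rows]
      exact Finset.sum_nonneg fun y _ => abs_nonneg _
    have h2 := doeblin_eq hW
    exact ⟨doeblin W / 2, ⟨by linarith, by linarith⟩, degradableInto_of_isBISO hW hB, by linarith⟩
  · rintro r ⟨p, -, hp, rfl⟩
    linarith [one_sub_two_mul_le_of_degradableInto hp]

end Doeblin

/-! ### Mutual information and relative entropy through the output entropy -/

section Entropy

variable {Y : Type*} {W : Matrix (Fin 2) Y ℝ}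

lemma hasDerivAt_outputAt (x : ℝ) (y : Y) :
    HasDerivAt (fun x => outputAt W x y) (halfDiff W y) x := by
  simpa [outputAt] using ((hasDerivAt_id x).mul_const (halfDiff W y)).const_add (midpoint W y)

variable [Fintype Y]

/-- If `U` takes the value `u` with probability `p u`, and the input has bias `x u` given
`U = u`, then `I(U : Y)` is the gap in Jensen's inequality for `negEntropyAt W`. -/
lemma mutualInfo_mul {k : ℕ} (hW : IsChannel W) {J : Matrix (Fin k) (Fin 2) ℝ} {p x : Fin k → ℝ}
    (hJ : IsJointDist J) (hp : ∀ u, p u = J u 0 + J u 1)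
    (hx : ∀ u, p u * x u = J u 0 - J u 1) :
    mutualInfo (J * W) = ∑ u, p u * negEntropyAt W (x u) - negEntropyAt W (∑ u, p u * x u) := by
  have hp1 : ∑ u, p u = 1 := by
    rw [← hJ.2]
    exact Finset.sum_congr rfl fun u _ => by rw [hp, Fin.sum_univ_two]
  have hA : ∀ u y, (J * W) u y = p u * outputAt W (x u) y := fun u y => by
    rw [outputAt, mul_add, ← mul_assoc, hx, hp, Matrix.mul_apply, Fin.sum_univ_two, midpoint,
      halfDiff]
    ring
  have hrow : ∀ u, ∑ y, (J * W) u y = p u := fun u => by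
    simp only [hA, ← Finset.mul_sum, sum_outputAt hW, mul_one]
  have hcol : ∀ y, ∑ u, (J * W) u y = outputAt W (∑ u, p u * x u) y := fun y => by
    simp only [hA, outputAt, mul_add, Finset.sum_add_distrib, ← Finset.sum_mul, hp1, one_mul,
      ← mul_assoc]
  have hA0 : ∀ u y, 0 ≤ (J * W) u y := fun u y => by
    rw [Matrix.mul_apply]
    exact Finset.sum_nonneg fun i _ => mul_nonneg (hJ.1 u i) ((hW i).1 y)
  have hterm : ∀ u y, (J * W) u y * Real.log ((J * W) u y /
      ((∑ y, (J * W) u y) * ∑ u, (J * W) u y)) =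
      p u * (outputAt W (x u) y * Real.log (outputAt W (x u) y)) -
        (J * W) u y * Real.log (outputAt W (∑ u, p u * x u) y) := fun u y => by
    rw [hrow, hcol]
    by_cases h : (J * W) u y = 0
    · have h' := h
      rw [hA] at h'
      rw [h, ← mul_assoc, h']
      ring
    · have hq : outputAt W (∑ u, p u * x u) y ≠ 0 := by
        rw [← hcol]
        exact ((hA0 u y).lt_of_ne' h |>.trans_le
          (Finset.single_le_sum (fun v _ => hA0 v y) (Finset.mem_univ u))).ne'
      have h' := h
      rw [hA] at h'
      have hpu := left_ne_zero_of_mul h'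
      rw [hA, mul_div_mul_left _ _ hpu, Real.log_div (right_ne_zero_of_mul h') hq]
      ring
  rw [mutualInfo, relEntropy, Fintype.sum_prod_type]
  simp only [hterm, Finset.sum_sub_distrib]
  congr 1
  · simp only [negEntropyAt, Finset.mul_sum]
  · rw [Finset.sum_comm]
    simp only [← Finset.sum_mul, hcol, negEntropyAt]

/-- Relative entropy between outputs is the Bregman divergence of `negEntropyAt W`. -/
lemma relEntropy_outputAt (hW : IsChannel W) (a : ℝ) {b : ℝ} (hb : |b| < 1) :
    relEntropy (outputAt W a) (outputAt W b) =
      negEntropyAt W a - negEntropyAt W b - negEntropyDeriv W b * (a - b) := by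
  have hterm : ∀ y, outputAt W a y * Real.log (outputAt W a y / outputAt W b y) =
      outputAt W a y * Real.log (outputAt W a y) - outputAt W b y * Real.log (outputAt W b y)
        - halfDiff W y * (Real.log (outputAt W b y) + 1) * (a - b) + halfDiff W y * (a - b) := by
    intro y
    have hlog : outputAt W a y * Real.log (outputAt W a y / outputAt W b y) =
        outputAt W a y * Real.log (outputAt W a y) -
          outputAt W a y * Real.log (outputAt W b y) := by
      by_cases hm : midpoint W y = 0
      · simp [outputAt, hm, halfDiff_eq_zero hW hm]
      · by_cases ha : outputAt W a y = 0
        · simp [ha]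
        · rw [Real.log_div ha (outputAt_pos hW hb hm).ne', mul_sub]
    have hab : outputAt W a y = outputAt W b y + halfDiff W y * (a - b) := by
      unfold outputAt
      ring
    rw [hlog]
    linear_combination (-Real.log (outputAt W b y)) * hab
  simp only [relEntropy, hterm, Finset.sum_add_distrib, Finset.sum_sub_distrib, ← Finset.sum_mul,
    sum_halfDiff hW, negEntropyAt, negEntropyDeriv]
  ring

lemma continuous_negEntropyAt : Continuous (negEntropyAt W) := by
  refine continuous_finsetSum _ fun y _ => ?_
  have h : Continuous fun x => outputAt W x y := by
    unfold outputAt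
    fun_prop
  exact Real.continuous_mul_log.comp h

lemma hasDerivAt_negEntropyAt (hW : IsChannel W) {x : ℝ} (hx : |x| < 1) :
    HasDerivAt (negEntropyAt W) (negEntropyDeriv W x) x := by
  refine HasDerivAt.fun_sum fun y _ => ?_
  by_cases hm : midpoint W y = 0
  · simpa [outputAt, hm, halfDiff_eq_zero hW hm] using hasDerivAt_const x (0 : ℝ)
  · have h := (Real.hasDerivAt_mul_log (outputAt_pos hW hx hm).ne').comp x
      (hasDerivAt_outputAt x y)
    rwa [mul_comm] at h

lemma hasDerivAt_negEntropyDeriv (hW : IsChannel W) {x : ℝ} (hx : |x| < 1) :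
    HasDerivAt (negEntropyDeriv W) (fisherInfo W x) x := by
  refine HasDerivAt.fun_sum fun y _ => ?_
  by_cases hm : midpoint W y = 0
  · simpa [outputAt, hm, halfDiff_eq_zero hW hm] using hasDerivAt_const x (0 : ℝ)
  · have h := (((hasDerivAt_outputAt x y).log (outputAt_pos hW hx hm).ne').add_const 1).const_mul
      (halfDiff W y)
    rwa [← mul_div_assoc, ← sq] at h

/-- A pointwise comparison of Fisher informations makes the difference of the negative entropies
convex. -/
lemma convexOn_negEntropyAt_sub {Z : Type*} [Fintype Z] {V : Matrix (Fin 2) Z ℝ}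
    (hW : IsChannel W) (hV : IsChannel V) (c : ℝ)
    (h : ∀ x, |x| < 1 → fisherInfo V x ≤ c * fisherInfo W x) :
    ConvexOn ℝ (Set.Icc (-1) 1) (fun x => c * negEntropyAt W x - negEntropyAt V x) := by
  refine convexOn_of_hasDerivWithinAt2_nonneg (convex_Icc _ _)
    (f' := fun x => c * negEntropyDeriv W x - negEntropyDeriv V x)
    (f'' := fun x => c * fisherInfo W x - fisherInfo V x) ?_ ?_ ?_ ?_
  · exact ((continuous_negEntropyAt.const_mul c).sub continuous_negEntropyAt).continuousOn
  all_goals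
    intro x hx
    rw [interior_Icc] at hx
    have hx' := abs_lt.2 hx
  · exact (((hasDerivAt_negEntropyAt hW hx').const_mul c).sub
      (hasDerivAt_negEntropyAt hV hx')).hasDerivWithinAt
  · exact (((hasDerivAt_negEntropyDeriv hW hx').const_mul c).sub
      (hasDerivAt_negEntropyDeriv hV hx')).hasDerivWithinAt
  · exact sub_nonneg.2 (h x hx')

/-- A channel with pointwise larger Fisher information is less noisy. -/
lemma lessNoisy_of_fisherInfo_le {Z : Type*} [Fintype Z] {V : Matrix (Fin 2) Z ℝ}
    (hW : IsChannel W) (hV : IsChannel V) (h : ∀ x, |x| < 1 → fisherInfo V x ≤ fisherInfo W x) :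
    LessNoisy W V := by
  intro k J hJ
  have hc := convexOn_negEntropyAt_sub hW hV 1 (by simpa using h)
  -- Where `J u 0 + J u 1 = 0` the quotient is `0`, which is a harmless choice of the bias.
  set p : Fin k → ℝ := fun u => J u 0 + J u 1 with hp
  set x : Fin k → ℝ := fun u => (J u 0 - J u 1) / p u with hx
  have hp0 : ∀ u, 0 ≤ p u := fun u => add_nonneg (hJ.1 u 0) (hJ.1 u 1)
  have hle : ∀ u, |J u 0 - J u 1| ≤ p u := fun u => by
    have h0 := hJ.1 u 0
    have h1 := hJ.1 u 1
    rw [abs_le]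
    constructor <;> simp only [hp] <;> linarith
  have hpx : ∀ u, p u * x u = J u 0 - J u 1 := fun u => by
    by_cases hu : p u = 0
    · have := hle u
      rw [hu] at this
      rw [hu, zero_mul, abs_nonpos_iff.1 this]
    · exact mul_div_cancel₀ _ hu
  have hx1 : ∀ u, x u ∈ Set.Icc (-1 : ℝ) 1 := fun u => by
    rw [Set.mem_Icc, ← abs_le, hx, abs_div, abs_of_nonneg (hp0 u)]
    exact div_le_one_of_le₀ (hle u) (hp0 u)
  have hp1 : ∑ u, p u = 1 := by
    rw [← hJ.2]
    exact Finset.sum_congr rfl fun u _ => by rw [hp, Fin.sum_univ_two]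
  rw [mutualInfo_mul hW hJ (fun _ => rfl) hpx, mutualInfo_mul hV hJ (fun _ => rfl) hpx]
  have := hc.map_sum_le (t := Finset.univ) (fun u _ => hp0 u) hp1 (fun u _ => hx1 u)
  simp only [smul_eq_mul, one_mul, mul_sub, Finset.sum_sub_distrib] at this
  linarith

end Entropy

/-! ### Symmetric channels -/

section Symmetric

variable {Y : Type*} {W : Matrix (Fin 2) Y ℝ}

lemma IsBISO.exists_perm (hB : IsBISO W) :
    ∃ e : Y ≃ Y, (∀ y, midpoint W (e y) = midpoint W y) ∧
      ∀ y, halfDiff W (e y) = -halfDiff W y := by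
  obtain ⟨σ, hσ, hs⟩ := hB
  have hs' : ∀ y, W 1 y = W 0 (σ y) := fun y => by rw [hs, hσ]
  refine ⟨hσ.toPerm, fun y => ?_, fun y => ?_⟩ <;>
    simp only [midpoint, halfDiff, Function.Involutive.coe_toPerm, hs y, hs' y] <;> ring

variable [Fintype Y]

lemma negEntropyAt_neg (hB : IsBISO W) (x : ℝ) : negEntropyAt W (-x) = negEntropyAt W x := by
  obtain ⟨e, hm, hd⟩ := hB.exists_perm
  rw [negEntropyAt, ← Equiv.sum_comp e]
  simp only [outputAt, hm, hd, neg_mul_neg, negEntropyAt]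

lemma negEntropyDeriv_zero (hB : IsBISO W) : negEntropyDeriv W 0 = 0 := by
  obtain ⟨e, hm, hd⟩ := hB.exists_perm
  have h : negEntropyDeriv W 0 = -negEntropyDeriv W 0 := by
    conv_lhs => rw [negEntropyDeriv, ← Equiv.sum_comp e]
    simp only [outputAt, hm, hd, zero_mul, add_zero, negEntropyDeriv, neg_mul,
      Finset.sum_neg_distrib]
  linarith

lemma fisherInfo_zero : fisherInfo W 0 = corrSq W := by
  simp [fisherInfo, corrSq, outputAt]

lemma corrSq_nonneg (hW : IsChannel W) : 0 ≤ corrSq W :=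
  Finset.sum_nonneg fun y _ => div_nonneg (sq_nonneg _) (midpoint_nonneg hW y)

lemma corrSq_le_one (hW : IsChannel W) : corrSq W ≤ 1 := by
  rw [← sum_midpoint hW]
  refine Finset.sum_le_sum fun y _ => ?_
  refine div_le_of_le_mul₀ (midpoint_nonneg hW y) (midpoint_nonneg hW y) ?_
  rw [← sq]
  exact sq_le_sq' (neg_le_of_abs_le (abs_halfDiff_le hW y)) (le_of_abs_le (abs_halfDiff_le hW y))

/-- Averaging the terms of two outputs exchanged by the symmetry. -/
lemma fisherInfo_eq_sum_symm (hW : IsChannel W) (hB : IsBISO W) {x : ℝ} (hx : |x| < 1) :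
    fisherInfo W x =
      ∑ y, halfDiff W y ^ 2 * midpoint W y / (midpoint W y ^ 2 - x ^ 2 * halfDiff W y ^ 2) := by
  obtain ⟨e, hm, hd⟩ := hB.exists_perm
  have h : fisherInfo W x = ∑ y, halfDiff W y ^ 2 / outputAt W (-x) y := by
    rw [fisherInfo, ← Equiv.sum_comp e]
    simp only [outputAt, hm, hd, neg_sq, neg_mul, mul_neg]
  have h2 : fisherInfo W x = (fisherInfo W x + ∑ y, halfDiff W y ^ 2 / outputAt W (-x) y) / 2 := by
    rw [← h]
    ring
  rw [h2, fisherInfo, ← Finset.sum_add_distrib, Finset.sum_div]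
  refine Finset.sum_congr rfl fun y _ => ?_
  by_cases hy : midpoint W y = 0
  · simp [halfDiff_eq_zero hW hy]
  have h3 := outputAt_pos hW hx hy
  have h4 := outputAt_pos hW (x := -x) (by rwa [abs_neg]) hy
  have h5 : midpoint W y ^ 2 - x ^ 2 * halfDiff W y ^ 2 = outputAt W x y * outputAt W (-x) y := by
    unfold outputAt
    ring
  rw [h5, div_add_div _ _ h3.ne' h4.ne', div_div, div_eq_div_iff (by positivity) (by positivity)]
  unfold outputAt
  ring

/-- With `s = d² / m²` each summand of the symmetrised Fisher information is `m s / (1 - x² s)`. -/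
lemma symm_term_eq {m d x : ℝ} (hm : m ≠ 0) :
    d ^ 2 * m / (m ^ 2 - x ^ 2 * d ^ 2) = m * (d ^ 2 / m ^ 2 / (1 - x ^ 2 * (d ^ 2 / m ^ 2))) := by
  have h : m ^ 2 - x ^ 2 * d ^ 2 = m ^ 2 * (1 - x ^ 2 * (d ^ 2 / m ^ 2)) := by
    field_simp
  rw [h, mul_comm (d ^ 2), mul_div_assoc, div_div]

lemma halfDiff_sq_div_le_one (hW : IsChannel W) (y : Y) :
    halfDiff W y ^ 2 / midpoint W y ^ 2 ≤ 1 :=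
  div_le_one_of_le₀ (sq_le_sq' (neg_le_of_abs_le (abs_halfDiff_le hW y))
    (le_of_abs_le (abs_halfDiff_le hW y))) (sq_nonneg _)

lemma one_sub_sq_mul_pos {x s : ℝ} (hx : |x| < 1) (hs : s ≤ 1) : 0 < 1 - x ^ 2 * s := by
  have h := (sq_lt_one_iff_abs_lt_one x).2 hx
  nlinarith [sq_nonneg x]

/-- Among symmetric channels with a given `corrSq`, erasure channels have the largest Fisher
information. -/
lemma fisherInfo_le (hW : IsChannel W) (hB : IsBISO W) {x : ℝ} (hx : |x| < 1) :
    fisherInfo W x ≤ corrSq W / (1 - x ^ 2) := by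
  rw [fisherInfo_eq_sum_symm hW hB hx, corrSq, Finset.sum_div]
  refine Finset.sum_le_sum fun y _ => ?_
  by_cases hy : midpoint W y = 0
  · simp [halfDiff_eq_zero hW hy]
  have hs := halfDiff_sq_div_le_one hW y
  have h1 : 0 < 1 - x ^ 2 := by simpa using one_sub_sq_mul_pos hx le_rfl
  have h2 : halfDiff W y ^ 2 / midpoint W y / (1 - x ^ 2) =
      midpoint W y * (halfDiff W y ^ 2 / midpoint W y ^ 2 / (1 - x ^ 2)) := by
    field_simp
  rw [symm_term_eq hy, h2]
  refine mul_le_mul_of_nonneg_left (div_le_div_of_nonneg_left (by positivity) h1 ?_)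
    (midpoint_nonneg hW y)
  nlinarith [sq_nonneg x]

/-- The gap between `s ↦ s / (1 - t s)` and its tangent line at `c`. -/
lemma div_one_sub_mul_sub_tangent {s c t : ℝ} (hs : 1 - t * s ≠ 0) (hc : 1 - t * c ≠ 0) :
    s / (1 - t * s) - (c / (1 - t * c) + (s - c) / (1 - t * c) ^ 2) =
      t * (s - c) ^ 2 / ((1 - t * s) * (1 - t * c) ^ 2) := by
  have hc2 := pow_ne_zero 2 hc
  rw [div_add_div _ _ hc hc2, div_sub_div _ _ hs (mul_ne_zero hc hc2),
    div_eq_div_iff (mul_ne_zero hs (mul_ne_zero hc hc2)) (mul_ne_zero hs hc2)]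
  ring

/-- Among symmetric channels with a given `corrSq`, binary symmetric channels have the smallest
Fisher information: this is Jensen's inequality for the convex function `s ↦ s / (1 - x² s)`, with
the weights `midpoint W`. -/
lemma le_fisherInfo (hW : IsChannel W) (hB : IsBISO W) {x : ℝ} (hx : |x| < 1) :
    corrSq W / (1 - x ^ 2 * corrSq W) ≤ fisherInfo W x := by
  set c := corrSq W with hc
  have hc1 := one_sub_sq_mul_pos hx (corrSq_le_one hW)
  rw [← hc] at hc1
  -- Summing the tangent line at `c` of `s ↦ s / (1 - x² s)` gives its value at the mean `c`.
  have hlin : ∑ y, (midpoint W y * (c / (1 - x ^ 2 * c)) +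
      (halfDiff W y ^ 2 / midpoint W y - midpoint W y * c) / (1 - x ^ 2 * c) ^ 2) =
      c / (1 - x ^ 2 * c) := by
    rw [Finset.sum_add_distrib, ← Finset.sum_mul, ← Finset.sum_div, Finset.sum_sub_distrib,
      ← Finset.sum_mul, sum_midpoint hW, ← corrSq, ← hc]
    simp
  rw [fisherInfo_eq_sum_symm hW hB hx, ← hlin]
  refine Finset.sum_le_sum fun y _ => ?_
  by_cases hy : midpoint W y = 0
  · simp [halfDiff_eq_zero hW hy, hy]
  rw [symm_term_eq hy]
  have hs1 := one_sub_sq_mul_pos hx (halfDiff_sq_div_le_one hW y)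
  have h2 : halfDiff W y ^ 2 / midpoint W y =
      midpoint W y * (halfDiff W y ^ 2 / midpoint W y ^ 2) := by
    field_simp
  rw [h2]
  set s := halfDiff W y ^ 2 / midpoint W y ^ 2
  rw [← mul_sub, mul_div_assoc, ← mul_add]
  refine mul_le_mul_of_nonneg_left ?_ (midpoint_nonneg hW y)
  rw [← sub_nonneg, div_one_sub_mul_sub_tangent hs1.ne' hc1.ne']
  positivity

/-- The second-order expansion of the output entropy at the uniform input. -/
lemma tendsto_negEntropyAt_div_sq (hW : IsChannel W) (hB : IsBISO W) :
    Tendsto (fun x => (negEntropyAt W x - negEntropyAt W 0) / x ^ 2) (𝓝[≠] 0)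
      (𝓝 (corrSq W / 2)) := by
  have hnear : ∀ᶠ x : ℝ in 𝓝[≠] 0, |x| < 1 := by
    refine nhdsWithin_le_nhds ?_
    filter_upwards [Metric.ball_mem_nhds (0 : ℝ) one_pos] with x hx
    simpa using hx
  have hslope : Tendsto (fun x => negEntropyDeriv W x / (2 * x)) (𝓝[≠] 0)
      (𝓝 (corrSq W / 2)) := by
    have h := (hasDerivAt_iff_tendsto_slope.1
      (hasDerivAt_negEntropyDeriv hW (x := 0) (by simp))).div_const 2
    rw [fisherInfo_zero] at h
    refine h.congr fun x => ?_
    rw [slope_def_field, negEntropyDeriv_zero hB, sub_zero, sub_zero, div_div, mul_comm]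
  refine HasDerivAt.lhopital_zero_nhdsNE (f' := negEntropyDeriv W) (g' := fun x => 2 * x)
    ?_ ?_ ?_ ?_ ?_ hslope
  · filter_upwards [hnear] with x hx
    exact (hasDerivAt_negEntropyAt hW hx).sub_const _
  · exact Eventually.of_forall fun x => by simpa using hasDerivAt_pow 2 x
  · filter_upwards [self_mem_nhdsWithin] with x hx
    exact mul_ne_zero two_ne_zero hx
  · refine tendsto_nhdsWithin_of_tendsto_nhds ?_
    have h : Continuous fun x => negEntropyAt W x - negEntropyAt W 0 :=
      continuous_negEntropyAt.sub continuous_const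
    simpa using h.tendsto 0
  · refine tendsto_nhdsWithin_of_tendsto_nhds ?_
    have h : Continuous fun x : ℝ => x ^ 2 := continuous_pow 2
    simpa using h.tendsto 0

/-- The inputs of bias `x` and `-x`, chosen by a fair coin, detect the second-order behaviour of the
output entropy at the uniform input as `x → 0`. -/
lemma corrSq_le_of_lessNoisy {Z : Type*} [Fintype Z] {V : Matrix (Fin 2) Z ℝ}
    (hW : IsChannel W) (hWB : IsBISO W) (hV : IsChannel V) (hVB : IsBISO V)
    (h : LessNoisy W V) : corrSq V ≤ corrSq W := by
  have hkey : ∀ x : ℝ, |x| < 1 →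
      negEntropyAt V x - negEntropyAt V 0 ≤ negEntropyAt W x - negEntropyAt W 0 := by
    intro x hx
    obtain ⟨h1, h2⟩ := abs_lt.1 hx
    set J : Matrix (Fin 2) (Fin 2) ℝ := !![(1 + x) / 4, (1 - x) / 4; (1 - x) / 4, (1 + x) / 4]
      with hJdef
    have hJ : IsJointDist J := by
      refine ⟨fun u i => ?_, ?_⟩
      · fin_cases u <;> fin_cases i <;> simp [hJdef] <;> linarith
      · simp [hJdef]
        ring
    have hp : ∀ u, (1 / 2 : ℝ) = J u 0 + J u 1 := fun u => by
      fin_cases u <;> simp [hJdef] <;> ring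
    have hx : ∀ u, 1 / 2 * (![x, -x] u : ℝ) = J u 0 - J u 1 := fun u => by
      fin_cases u <;> simp [hJdef] <;> ring
    have := h 2 J hJ
    rw [mutualInfo_mul hW hJ hp hx, mutualInfo_mul hV hJ hp hx] at this
    simp only [Fin.sum_univ_two, Matrix.cons_val_zero, Matrix.cons_val_one,
      negEntropyAt_neg hWB, negEntropyAt_neg hVB, mul_neg, add_neg_cancel] at this
    linarith
  have hle := le_of_tendsto_of_tendsto (tendsto_negEntropyAt_div_sq hV hVB)
    (tendsto_negEntropyAt_div_sq hW hWB) (by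
      refine nhdsWithin_le_nhds ?_
      filter_upwards [Metric.ball_mem_nhds (0 : ℝ) one_pos] with x hx
      exact div_le_div_of_nonneg_right (hkey x (by simpa using hx)) (sq_nonneg x))
  linarith

end Symmetric

/-! ### The extremal symmetric channels -/

section Extremal

lemma isChannel_BSC {p : ℝ} (hp : p ∈ Set.Icc (0 : ℝ) 1) : IsChannel (BSC p) := by
  intro i
  refine ⟨fun j => ?_, ?_⟩
  · fin_cases i <;> fin_cases j <;> simp [BSC, hp.1, hp.2]
  · fin_cases i <;> simp [BSC]

lemma isBISO_BSC (p : ℝ) : IsBISO (BSC p) :=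
  ⟨Fin.rev, Fin.rev_rev, fun j => by fin_cases j <;> simp [BSC, Fin.rev]⟩

lemma isChannel_BEC {ε : ℝ} (hε : ε ∈ Set.Icc (0 : ℝ) 1) : IsChannel (BEC ε) := by
  intro i
  refine ⟨fun j => ?_, ?_⟩
  · fin_cases i <;> fin_cases j <;> simp [BEC, hε.1, hε.2]
  · fin_cases i <;> simp [BEC, Fin.sum_univ_three]

lemma isBISO_BEC (ε : ℝ) : IsBISO (BEC ε) :=
  ⟨Fin.rev, Fin.rev_rev, fun j => by fin_cases j <;> simp [BEC, Fin.rev]⟩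

lemma one_eq_BSC_zero : (1 : Matrix (Fin 2) (Fin 2) ℝ) = BSC 0 := by
  ext i j
  fin_cases i <;> fin_cases j <;> simp [BSC]

lemma isChannel_one : IsChannel (1 : Matrix (Fin 2) (Fin 2) ℝ) := by
  rw [one_eq_BSC_zero]
  exact isChannel_BSC (by simp)

lemma isBISO_one : IsBISO (1 : Matrix (Fin 2) (Fin 2) ℝ) := by
  rw [one_eq_BSC_zero]
  exact isBISO_BSC 0

lemma fisherInfo_BSC {p x : ℝ} (hp : p ∈ Set.Icc (0 : ℝ) 1) (hx : |x| < 1) :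
    fisherInfo (BSC p) x = (1 - 2 * p) ^ 2 / (1 - x ^ 2 * (1 - 2 * p) ^ 2) := by
  have hm : ∀ j, midpoint (BSC p) j = 1 / 2 := fun j => by
    fin_cases j <;> simp [midpoint, BSC]
  have hd : ∀ j, halfDiff (BSC p) j ^ 2 = (1 - 2 * p) ^ 2 / 4 := fun j => by
    fin_cases j <;> simp [halfDiff, BSC] <;> ring
  have hpos : 0 < 1 - x ^ 2 * (1 - 2 * p) ^ 2 :=
    one_sub_sq_mul_pos hx (by nlinarith [hp.1, hp.2])
  have h4 : (1 / 2 : ℝ) ^ 2 - x ^ 2 * ((1 - 2 * p) ^ 2 / 4) =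
      (1 - x ^ 2 * (1 - 2 * p) ^ 2) / 4 := by ring
  rw [fisherInfo_eq_sum_symm (isChannel_BSC hp) (isBISO_BSC p) hx]
  simp only [hm, hd, h4, Fin.sum_univ_two]
  field_simp
  ring

lemma corrSq_BSC {p : ℝ} (hp : p ∈ Set.Icc (0 : ℝ) 1) : corrSq (BSC p) = (1 - 2 * p) ^ 2 := by
  rw [← fisherInfo_zero, fisherInfo_BSC hp (by simp)]
  simp

lemma fisherInfo_one {x : ℝ} (hx : |x| < 1) :
    fisherInfo (1 : Matrix (Fin 2) (Fin 2) ℝ) x = 1 / (1 - x ^ 2) := by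
  rw [one_eq_BSC_zero, fisherInfo_BSC (by simp) hx]
  simp

lemma corrSq_one : corrSq (1 : Matrix (Fin 2) (Fin 2) ℝ) = 1 := by
  rw [one_eq_BSC_zero, corrSq_BSC (by simp)]
  simp

lemma fisherInfo_BEC {ε x : ℝ} (hx : |x| < 1) :
    fisherInfo (BEC ε) x = (1 - ε) / (1 - x ^ 2) := by
  obtain ⟨h1, h2⟩ := abs_lt.1 hx
  have h3 : (1 + x) ≠ 0 := by linarith
  have h4 : (1 - x) ≠ 0 := by linarith
  have h5 : 1 - x ^ 2 = (1 + x) * (1 - x) := by ring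
  have e0 : halfDiff (BEC ε) 0 ^ 2 / outputAt (BEC ε) x 0 = (1 - ε) / (2 * (1 + x)) := by
    simp only [halfDiff, outputAt, midpoint, BEC, Matrix.of_apply, Matrix.cons_val]
    by_cases hε : 1 - ε = 0
    · simp [hε]
    · rw [show (1 - ε + 0) / 2 + x * ((1 - ε - 0) / 2) = (1 - ε) * (1 + x) / 2 by ring]
      field_simp
      ring
  have e1 : halfDiff (BEC ε) 1 ^ 2 / outputAt (BEC ε) x 1 = 0 := by
    simp [halfDiff, BEC]
  have e2 : halfDiff (BEC ε) 2 ^ 2 / outputAt (BEC ε) x 2 = (1 - ε) / (2 * (1 - x)) := by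
    simp only [halfDiff, outputAt, midpoint, BEC, Matrix.of_apply, Matrix.cons_val]
    by_cases hε : 1 - ε = 0
    · simp [hε]
    · rw [show (0 + (1 - ε)) / 2 + x * ((0 - (1 - ε)) / 2) = (1 - ε) * (1 - x) / 2 by ring]
      field_simp
      ring
  rw [fisherInfo, Fin.sum_univ_three, e0, e1, e2, h5]
  field_simp
  ring

lemma corrSq_BEC (ε : ℝ) : corrSq (BEC ε) = 1 - ε := by
  rw [← fisherInfo_zero, fisherInfo_BEC (by simp)]
  simp

end Extremal

/-! ### The less-noisy coefficients and the contraction coefficient -/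

section Main

variable {Y : Type*} [Fintype Y] {W : Matrix (Fin 2) Y ℝ}

lemma lnCoeff_eq (hW : IsChannel W) (hB : IsBISO W) : lnCoeff W = 1 - corrSq W := by
  have h0 := corrSq_nonneg hW
  have h1 := corrSq_le_one hW
  refine IsGreatest.csSup_eq ⟨?_, ?_⟩
  · have hε : 1 - corrSq W ∈ Set.Icc (0 : ℝ) 1 := ⟨by linarith, by linarith⟩
    refine ⟨hε, lessNoisy_of_fisherInfo_le (isChannel_BEC hε) hW fun x hx => ?_⟩
    rw [fisherInfo_BEC hx, sub_sub_cancel]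
    exact fisherInfo_le hW hB hx
  · rintro ε ⟨hε, hln⟩
    have h := corrSq_le_of_lessNoisy (isChannel_BEC hε) (isBISO_BEC ε) hW hB hln
    rw [corrSq_BEC] at h
    linarith

lemma reverseLnCoeff_eq (hW : IsChannel W) (hB : IsBISO W) :
    reverseLnCoeff W = 1 - corrSq W := by
  have h0 := corrSq_nonneg hW
  have h1 := corrSq_le_one hW
  refine IsLeast.csInf_eq ⟨?_, ?_⟩
  · have hs := Real.sq_sqrt h0
    have hs0 := Real.sqrt_nonneg (corrSq W)
    have hs1 := Real.sqrt_le_one.2 h1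
    have hp : (1 - √(corrSq W)) / 2 ∈ Set.Icc (0 : ℝ) 1 := ⟨by linarith, by linarith⟩
    have hθ : (1 - 2 * ((1 - √(corrSq W)) / 2)) ^ 2 = corrSq W := by
      linear_combination hs
    refine ⟨_, hp, lessNoisy_of_fisherInfo_le hW (isChannel_BSC hp) fun x hx => ?_, ?_⟩
    · rw [fisherInfo_BSC hp hx, hθ]
      exact le_fisherInfo hW hB hx
    · linear_combination hs
  · rintro r ⟨p, hp, hln, rfl⟩
    have h := corrSq_le_of_lessNoisy hW hB (isChannel_BSC hp) (isBISO_BSC p) hln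
    rw [corrSq_BSC hp] at h
    linarith

/-- A convex function lies above its tangent lines. -/
lemma _root_.ConvexOn.add_deriv_mul_le {S : Set ℝ} {f : ℝ → ℝ} {f' a b : ℝ} (hf : ConvexOn ℝ S f)
    (ha : a ∈ S) (hb : b ∈ S) (hd : HasDerivAt f f' b) : f b + f' * (a - b) ≤ f a := by
  rcases lt_trichotomy a b with h | rfl | h
  · have := hf.slope_le_of_hasDerivAt ha hb h hd
    rw [slope_def_field, div_le_iff₀ (sub_pos.2 h)] at this
    linarith
  · simp
  · have := hf.le_slope_of_hasDerivAt hb ha h hd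
    rw [slope_def_field, le_div_iff₀ (sub_pos.2 h)] at this
    linarith

lemma relEntropy_eq_outputAt_one {P Q : Fin 2 → ℝ}
    (hP : P ∈ stdSimplex ℝ (Fin 2)) (hQ : Q ∈ stdSimplex ℝ (Fin 2)) :
    relEntropy P Q = relEntropy (outputAt (1 : Matrix (Fin 2) (Fin 2) ℝ) (P 0 - P 1))
      (outputAt (1 : Matrix (Fin 2) (Fin 2) ℝ) (Q 0 - Q 1)) := by
  rw [← vecMul_eq_outputAt hP, ← vecMul_eq_outputAt hQ, Matrix.vecMul_one, Matrix.vecMul_one]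

/-- The strong data processing inequality with the constant `corrSq W`: the Bregman divergence of
the convex function `corrSq W * negEntropyAt 1 - negEntropyAt W` is nonnegative. -/
lemma relEntropy_vecMul_le (hW : IsChannel W) (hB : IsBISO W) {P Q : Fin 2 → ℝ}
    (hP : P ∈ stdSimplex ℝ (Fin 2)) (hQ : Q ∈ stdSimplex ℝ (Fin 2)) (hb : |Q 0 - Q 1| < 1) :
    relEntropy (P ᵥ* W) (Q ᵥ* W) ≤ corrSq W * relEntropy P Q := by
  rw [relEntropy_eq_outputAt_one hP hQ, vecMul_eq_outputAt hP, vecMul_eq_outputAt hQ,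
    relEntropy_outputAt hW _ hb, relEntropy_outputAt isChannel_one _ hb]
  have hc := convexOn_negEntropyAt_sub isChannel_one hW (corrSq W) fun x hx => by
    rw [fisherInfo_one hx, mul_one_div]
    exact fisherInfo_le hW hB hx
  have h := hc.add_deriv_mul_le (abs_le.1 (abs_bias_le_one hP)) (abs_le.1 hb.le)
    (((hasDerivAt_negEntropyAt isChannel_one hb).const_mul (corrSq W)).sub
      (hasDerivAt_negEntropyAt hW hb))
  linarith

/-- Comparing a distribution of small bias with the uniform one shows that the constant in the
strong data processing inequality is sharp. -/
lemma tendsto_relEntropy_div (hW : IsChannel W) (hB : IsBISO W) :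
    Tendsto (fun x => relEntropy (outputAt W x) (outputAt W 0) /
      relEntropy (outputAt (1 : Matrix (Fin 2) (Fin 2) ℝ) x)
        (outputAt (1 : Matrix (Fin 2) (Fin 2) ℝ) 0)) (𝓝[≠] 0) (𝓝 (corrSq W)) := by
  have h := (tendsto_negEntropyAt_div_sq hW hB).div
    (tendsto_negEntropyAt_div_sq isChannel_one isBISO_one) (by simp [corrSq_one])
  rw [corrSq_one, div_div_div_cancel_right₀ two_ne_zero, div_one] at h
  refine h.congr' ?_
  filter_upwards [self_mem_nhdsWithin] with x hx
  have h0 : |(0 : ℝ)| < 1 := by simp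
  rw [Pi.div_apply, div_div_div_cancel_right₀ (pow_ne_zero 2 hx), relEntropy_outputAt hW x h0,
    relEntropy_outputAt isChannel_one x h0, negEntropyDeriv_zero hB,
    negEntropyDeriv_zero isBISO_one, zero_mul, sub_zero, sub_zero]

lemma etaKL_eq (hW : IsChannel W) (hB : IsBISO W) : etaKL W = corrSq W := by
  have hub : ∀ r ∈ {r : ℝ | ∃ P ∈ stdSimplex ℝ (Fin 2), ∃ Q ∈ stdSimplex ℝ (Fin 2), P ≠ Q ∧
      AbsCont P Q ∧ r = relEntropy (P ᵥ* W) (Q ᵥ* W) / relEntropy P Q}, r ≤ corrSq W := by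
    rintro r ⟨P, hP, Q, hQ, hne, hac, rfl⟩
    have hb := abs_bias_lt_one hP hQ hne hac
    have h := relEntropy_vecMul_le hW hB hP hQ hb
    -- Nonnegativity of relative entropy is convexity of `negEntropyAt 1`, written as `2 F - F`.
    have hnonneg : 0 ≤ relEntropy P Q := by
      have hc := convexOn_negEntropyAt_sub isChannel_one isChannel_one 2 fun x hx => by
        rw [fisherInfo_one hx]
        have := one_sub_sq_mul_pos hx le_rfl
        have : 0 < 1 / (1 - x ^ 2) := by simpa using this
        linarith
      have h := hc.add_deriv_mul_le (abs_le.1 (abs_bias_le_one hP)) (abs_le.1 hb.le)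
        (((hasDerivAt_negEntropyAt isChannel_one hb).const_mul 2).sub
          (hasDerivAt_negEntropyAt isChannel_one hb))
      rw [relEntropy_eq_outputAt_one hP hQ, relEntropy_outputAt isChannel_one _ hb]
      linarith
    exact div_le_of_le_mul₀ hnonneg (corrSq_nonneg hW) h
  have hnear : ∀ᶠ x : ℝ in 𝓝[≠] 0, relEntropy (outputAt W x) (outputAt W 0) /
      relEntropy (outputAt (1 : Matrix (Fin 2) (Fin 2) ℝ) x)
        (outputAt (1 : Matrix (Fin 2) (Fin 2) ℝ) 0) ∈
      {r : ℝ | ∃ P ∈ stdSimplex ℝ (Fin 2), ∃ Q ∈ stdSimplex ℝ (Fin 2), P ≠ Q ∧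
        AbsCont P Q ∧ r = relEntropy (P ᵥ* W) (Q ᵥ* W) / relEntropy P Q} := by
    filter_upwards [self_mem_nhdsWithin,
      nhdsWithin_le_nhds (Metric.ball_mem_nhds (0 : ℝ) one_pos)] with x hx hx1
    have hP := biased_mem (x := x) (by simpa using (Metric.mem_ball.1 hx1).le)
    have hQ := biased_mem (x := 0) (by simp)
    refine ⟨_, hP, _, hQ, fun h => hx ?_, fun i hi => ?_, ?_⟩
    · have h1 := biased_sub x
      rw [h, biased_sub] at h1
      exact h1.symm
    · fin_cases i <;> norm_num [biased] at hi
    · rw [relEntropy_eq_outputAt_one hP hQ, vecMul_eq_outputAt hP, vecMul_eq_outputAt hQ,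
        biased_sub, biased_sub]
  obtain ⟨x, hx⟩ := hnear.exists
  refine le_antisymm (csSup_le ⟨_, hx⟩ hub) ?_
  exact le_of_tendsto (tendsto_relEntropy_div hW hB)
    (hnear.mono fun x hx => le_csSup ⟨_, hub⟩ hx)

end Main

end InfoTheory

theorem mainTheorem4 {Y : Type*} [Fintype Y] (W : Matrix (Fin 2) Y ℝ)
    (hW : InfoTheory.IsChannel W) (hB : InfoTheory.IsBISO W) :
    (InfoTheory.doeblin W = InfoTheory.reverseDoeblin W ∧
      InfoTheory.reverseDoeblin W = 1 - InfoTheory.etaTV W) ∧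
    (InfoTheory.lnCoeff W = InfoTheory.reverseLnCoeff W ∧
      InfoTheory.reverseLnCoeff W = 1 - InfoTheory.etaKL W) := by
  open InfoTheory in
  exact ⟨⟨by rw [doeblin_eq hW, reverseDoeblin_eq hW hB],
      by rw [reverseDoeblin_eq hW hB, etaTV_eq]⟩,
    ⟨by rw [lnCoeff_eq hW hB, reverseLnCoeff_eq hW hB],
      by rw [reverseLnCoeff_eq hW hB, etaKL_eq hW hB]⟩⟩
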